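/- Theorem 5.7 (Witt). Let $F$ be a free group of finite rank $q\ge 0$, and let $F=\gamma_1(F)\ge\gamma_2(F)\ge\cdots$ be its lower central series, $\gamma_{i+1}(F)=[\gamma_i(F),F]$. For every integer $w\ge 1$, the abelian group $\gamma_w(F)/\gamma_{w+1}(F)$ is a finitely generated free abelian group, and its rank is $$n(w,q)=\frac1w\sum_{d\mid w}\mu(d)\,q^{w/d},$$ where $d$ runs over the positive divisors of $w$ and $\mu$ is the Möbius function, i.e. $\mu(d)=(-1)^r$ if $d$ is a product of $r\ge 0$ distinct primes and $\mu(d)=0$ otherwise. -/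

import Mathlib

/-- The `i`-th term `γ_i(G)` of the lower central series, numbered from `γ_1(G) = G`, so that
`γ_{i+1}(G) = [γ_i(G), G]` for `i ≥ 1`. Mathlib numbers the same series from `0`.
(Only `i ≥ 1` is meaningful; `lowerCentralTerm G 0` is `G`.) -/
def lowerCentralTerm (G : Type*) [Group G] (i : ℕ) : Subgroup G :=
  (⊤ : Subgroup G).lowerCentralSeries (i - 1)

instance lowerCentralTerm_normal (G : Type*) [Group G] (i : ℕ) :
    (lowerCentralTerm G i).Normal := by
  unfold lowerCentralTerm
  infer_instance

theorem lowerCentralTerm_one (G : Type*) [Group G] : lowerCentralTerm G 1 = ⊤ := rfl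

theorem lowerCentralTerm_succ (G : Type*) [Group G] {i : ℕ} (hi : 1 ≤ i) :
    lowerCentralTerm G (i + 1) = ⁅lowerCentralTerm G i, (⊤ : Subgroup G)⁆ := by
  obtain ⟨j, rfl⟩ := Nat.exists_eq_add_of_le' hi
  rfl

theorem commutator_mem_lowerCentralTerm_succ (G : Type*) [Group G] (i : ℕ) {x : G}
    (hx : x ∈ lowerCentralTerm G i) (y : G) : x * y * x⁻¹ * y⁻¹ ∈ lowerCentralTerm G (i + 1) := by
  cases i with
  | zero => exact Subgroup.mem_top _
  | succ j => exact Subgroup.commutator_mem_commutator hx (Subgroup.mem_top y)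

/-- The lower central factor `γ_w(G) / γ_{w+1}(G)`. -/
abbrev LowerCentralFactor (G : Type*) [Group G] (w : ℕ) : Type _ :=
  lowerCentralTerm G w ⧸ (lowerCentralTerm G (w + 1)).subgroupOf (lowerCentralTerm G w)

/-- The quotient group `γ_w(G) / γ_{w+1}(G)` is abelian. -/
instance lowerCentralFactor_commGroup (G : Type*) [Group G] (w : ℕ) :
    CommGroup (LowerCentralFactor G w) :=
  { (inferInstance : Group (LowerCentralFactor G w)) with
    mul_comm := by
      rintro ⟨x⟩ ⟨y⟩
      refine QuotientGroup.eq.mpr ?_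
      rw [Subgroup.mem_subgroupOf]
      have h := commutator_mem_lowerCentralTerm_succ G w
        (inv_mem y.2) ((x : G)⁻¹)
      simpa [mul_assoc] using h }

/-! The Lyndon words of length `w` index a basis of the factor of weight `w`. A Lyndon word has
exactly one standard bracketing, obtained by repeatedly splitting off the least proper suffix
(`exists_isStandard`, `IsStandard.word_injective`); read as an iterated commutator, it gives an
element of γ_w.

Generation: modulo higher weight, commutators are bilinear, alternating and satisfy the Jacobi
identity. Rewriting with these rules puts the commutator of two standard commutators into the
subgroup generated by standard ones and the next term of the series
(`commutator_mem_standardSpan_of_lt`).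

Independence: the Magnus map x_i ↦ 1 + x_i X sends γ_w to units 1 + X^w(...), and the coefficient of
X^w is additive on the factor. It sends a standard commutator to a Lie polynomial whose smallest
word is the Lyndon word itself, with coefficient 1 (`IsStandard.liePoly_sub_mem`), so these images
are triangular.

Counting: every sequence of minimal period d is one of the d shifts of a unique sequence with Lyndon
initial word. Hence q^n = ∑_{d ∣ n} d L(d), where L(d) counts Lyndon words, and Möbius inversion
gives the formula. -/

open scoped commutatorElement

/-! ### Lyndon words and the factorisation at the least suffix. -/

namespace List

variable {α : Type*} [LinearOrder α]

/-- A lexicographic inequality holds either because of a proper prefix or at a first differing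
letter; in the latter case it survives arbitrary extensions on both sides. -/
theorem exists_append_or_forall_append_lt {u v : List α} (h : u < v) :
    (∃ t, t ≠ [] ∧ v = u ++ t) ∨ ∀ s t, u ++ s < v ++ t := by
  induction u generalizing v with
  | nil =>
    cases v with
    | nil => exact absurd h (lt_irrefl _)
    | cons b v => exact Or.inl ⟨b :: v, by simp, rfl⟩
  | cons a u ih =>
    cases v with
    | nil => exact absurd h (by simp)
    | cons b v =>
      rcases List.cons_lt_cons_iff.1 h with hab | ⟨rfl, huv⟩
      · exact Or.inr fun s t => List.cons_lt_cons_iff.2 (Or.inl hab)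
      · rcases ih huv with ⟨t, ht, rfl⟩ | H
        · exact Or.inl ⟨t, ht, rfl⟩
        · exact Or.inr fun s t => List.cons_lt_cons_iff.2 (Or.inr ⟨rfl, H s t⟩)

theorem append_lt_append_iff_left (u : List α) {v w : List α} : u ++ v < u ++ w ↔ v < w := by
  induction u with
  | nil => rfl
  | cons a u ih => simp [ih]

theorem append_le_append_iff_left (u : List α) {v w : List α} : u ++ v ≤ u ++ w ↔ v ≤ w := by
  rw [← not_lt, ← not_lt, append_lt_append_iff_left]

theorem lt_append_of_ne_nil (u : List α) {s : List α} (hs : s ≠ []) : u < u ++ s := by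
  have h : ([] : List α) < s := by
    cases s with
    | nil => exact absurd rfl hs
    | cons a s => simp
  simpa using (append_lt_append_iff_left u).2 h

theorem append_lt_append_of_length_eq {u v : List α} (h : u < v) (hl : u.length = v.length)
    (s t : List α) : u ++ s < v ++ t := by
  rcases exists_append_or_forall_append_lt h with ⟨r, hr, rfl⟩ | H
  · exact absurd hl (by simp [hr])
  · exact H s t

/-- A Lyndon word is a nonempty word that is smaller than each of its proper nonempty suffixes. -/
def IsLyndon (w : List α) : Prop :=
  w ≠ [] ∧ ∀ u v, w = u ++ v → u ≠ [] → v ≠ [] → w < v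

theorem isLyndon_singleton (a : α) : [a].IsLyndon := by
  refine ⟨by simp, fun u v h hu hv => ?_⟩
  have := congrArg length h
  have := length_pos_iff.2 hu
  have := length_pos_iff.2 hv
  simp at *
  omega

theorem IsLyndon.append_lt {u v : List α} (hv : v.IsLyndon) (hu : u ≠ [])
    (h : u < v) : u ++ v < v := by
  rcases exists_append_or_forall_append_lt h with ⟨t, ht, rfl⟩ | H
  · exact (append_lt_append_iff_left u).2 (hv.2 u t rfl hu ht)
  · simpa using H v []

omit [LinearOrder α] in
theorem append_eq_append_cases {u v a b : List α} (h : u ++ v = a ++ b) :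
    (∃ s, a = u ++ s ∧ v = s ++ b) ∨ ∃ s, s ≠ [] ∧ u = a ++ s ∧ b = s ++ v := by
  rcases List.append_eq_append_iff.1 h with ⟨s, h1, h2⟩ | ⟨s, h1, h2⟩
  · exact Or.inl ⟨s, h1, h2⟩
  · rcases eq_or_ne s [] with rfl | hs
    · exact Or.inl ⟨[], by simp_all, by simp_all⟩
    · exact Or.inr ⟨s, hs, h1, h2⟩

/-- Suffixes inside `v` are at least `v`, which exceeds `u ++ v`. A suffix starting inside `u`
begins with a proper suffix of `u`; that one exceeds `u` but is too short to have `u` as a prefix,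
so a letter decides. -/
theorem IsLyndon.append {u v : List α} (hu : u.IsLyndon) (hv : v.IsLyndon) (h : u < v) :
    (u ++ v).IsLyndon := by
  have huv := hv.append_lt hu.1 h
  refine ⟨by simp [hu.1], fun a b hab ha hb => ?_⟩
  rcases append_eq_append_cases hab with ⟨s, rfl, rfl⟩ | ⟨s, hs, rfl, rfl⟩
  · rcases eq_or_ne s [] with rfl | hs
    · simpa using huv
    · exact huv.trans (hv.2 s b rfl hs hb)
  · rcases exists_append_or_forall_append_lt (hu.2 a s rfl ha hs) with ⟨t, ht, h1⟩ | H
    · have := congrArg length h1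
      simp at this
      have := length_pos_iff.2 ha
      omega
    · exact H _ _

/-- Every word of length at least two has a least proper nonempty suffix. -/
theorem exists_least_suffix {w : List α} (hw : 2 ≤ w.length) :
    ∃ u v, w = u ++ v ∧ u ≠ [] ∧ v ≠ [] ∧
      ∀ a b, w = a ++ b → a ≠ [] → b ≠ [] → v ≤ b := by
  obtain ⟨i, hi, hmin⟩ := Finset.exists_min_image (Finset.Ioo 0 w.length) (fun i => w.drop i)
    ⟨1, by simp; omega⟩
  rw [Finset.mem_Ioo] at hi
  refine ⟨w.take i, w.drop i, (take_append_drop i w).symm, ?_, ?_, fun a b hab ha hb => ?_⟩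
  · rw [← length_pos_iff, length_take]; omega
  · rw [← length_pos_iff, length_drop]; omega
  · have h := hmin a.length (by
      rw [Finset.mem_Ioo, hab, length_append]
      have := length_pos_iff.2 ha
      have := length_pos_iff.2 hb
      omega)
    simpa [hab] using h

theorem IsLyndon.of_least_suffix_right {u v : List α} (hu : u ≠ []) (hv : v ≠ [])
    (hmin : ∀ a b, u ++ v = a ++ b → a ≠ [] → b ≠ [] → v ≤ b) : v.IsLyndon := by
  refine ⟨hv, fun a b hab ha hb => lt_of_le_of_ne
    (hmin (u ++ a) b (by simp [hab]) (by simp [hu]) hb) fun h => ?_⟩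
  rw [h] at hab
  exact ha (by simpa using hab)

/-- Let `s` be a proper suffix of `u` with `s < u`. If `u = s ++ r`, then `u ++ v < s ++ v` gives `r
++ v < v`, against minimality of `v`; otherwise `s ++ v < u ++ v`, against the Lyndon property. -/
theorem IsLyndon.of_least_suffix_left {u v : List α} (hw : (u ++ v).IsLyndon) (hu : u ≠ [])
    (hv : v ≠ []) (hmin : ∀ a b, u ++ v = a ++ b → a ≠ [] → b ≠ [] → v ≤ b) : u.IsLyndon := by
  refine ⟨hu, fun a s has ha hs => ?_⟩
  by_contra hlt
  have hne : s ≠ u := by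
    rintro rfl
    exact ha (by simpa using has)
  have hsu : s < u := lt_of_le_of_ne (not_lt.1 hlt) hne
  have hwsv : u ++ v < s ++ v := hw.2 a (s ++ v) (by simp [has]) ha (by simp [hv])
  rcases exists_append_or_forall_append_lt hsu with ⟨r, hr, rfl⟩ | H
  · rw [append_assoc, append_lt_append_iff_left] at hwsv
    exact absurd (hmin s (r ++ v) (by simp) hs (by simp [hv])) (not_le.2 hwsv)
  · exact lt_asymm hwsv (H _ _)

end List

/-! ### Standard bracketings correspond to Lyndon words. -/

namespace FreeMagma

open List

variable {α : Type*}

/-- The word of leaves of a binary tree, read from left to right. -/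
def word : FreeMagma α → List α
  | .of a => [a]
  | .mul x y => word x ++ word y

@[simp] theorem word_of (a : α) : (of a).word = [a] := rfl
@[simp] theorem word_mul (x y : FreeMagma α) : (x * y).word = x.word ++ y.word := rfl

@[simp] theorem length_word (t : FreeMagma α) : t.word.length = t.length := by
  induction t with
  | ih1 a => rfl
  | ih2 x y ihx ihy =>
    rw [word_mul, length_append, ihx, ihy]
    rfl

theorem word_ne_nil (t : FreeMagma α) : t.word ≠ [] := by
  rw [← length_pos_iff, length_word]
  exact t.length_pos

theorem length_mul (x y : FreeMagma α) : (x * y).length = x.length + y.length := rfl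

variable [LinearOrder α]

/-- The standard bracketings of Lyndon words. -/
def IsStandard : FreeMagma α → Prop
  | .of _ => True
  | .mul x y => IsStandard x ∧ IsStandard y ∧ x.word < y.word ∧
      ∀ x₁ x₂, x = x₁ * x₂ → y.word ≤ x₂.word

theorem IsStandard.isLyndon {t : FreeMagma α} (ht : t.IsStandard) : t.word.IsLyndon := by
  induction t with
  | ih1 a => exact isLyndon_singleton a
  | ih2 x y ihx ihy => exact (ihx ht.1).append (ihy ht.2.1) ht.2.2.1

/-- The local condition on `x₂` makes the right factor the globally least suffix: for a suffix `s ++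
y` reaching into `x = x₁ * x₂`, induction yields `y ≤ x₂ ≤ s < s ++ y`. The word therefore
determines the split. -/
theorem IsStandard.le_suffix {x y : FreeMagma α} (ht : (x * y).IsStandard) {a b : List α}
    (hab : x.word ++ y.word = a ++ b) (ha : a ≠ []) (hb : b ≠ []) : y.word ≤ b := by
  induction x generalizing y a b with
  | ih1 c =>
    rcases append_eq_append_cases hab with ⟨s, rfl, h⟩ | ⟨s, hs, h, rfl⟩
    · rcases eq_or_ne s [] with rfl | hs
      · exact h.le
      · exact (ht.2.1.isLyndon.2 s b h hs hb).le
    · have := congrArg List.length h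
      have := length_pos_iff.2 ha
      have := length_pos_iff.2 hs
      simp at *
      omega
  | ih2 x₁ x₂ ihx _ =>
    rcases append_eq_append_cases hab with ⟨s, rfl, h⟩ | ⟨s, hs, h, rfl⟩
    · rcases eq_or_ne s [] with rfl | hs
      · exact h.le
      · exact (ht.2.1.isLyndon.2 s b h hs hb).le
    · have h1 : x₂.word ≤ s := by
        exact ihx ht.1 h ha hs
      exact (ht.2.2.2 _ _ rfl).trans (h1.trans (lt_append_of_ne_nil s y.word_ne_nil).le)

theorem IsStandard.word_injective {s t : FreeMagma α} (hs : s.IsStandard) (ht : t.IsStandard)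
    (h : s.word = t.word) : s = t := by
  induction s generalizing t with
  | ih1 a =>
    cases t using recOnMul with
    | ih1 b => exact congrArg of (by simpa using h)
    | ih2 x y =>
      have := congrArg List.length h
      have := x.length_pos
      have := y.length_pos
      simp at *
      omega
  | ih2 x y ihx ihy =>
    cases t using recOnMul with
    | ih1 b =>
      have := congrArg List.length h
      have := x.length_pos
      have := y.length_pos
      simp at *
      omega
    | ih2 x' y' =>
      have h1 : y.word = y'.word := le_antisymm
        (hs.le_suffix h x'.word_ne_nil y'.word_ne_nil)
        (ht.le_suffix h.symm x.word_ne_nil y.word_ne_nil)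
      have h2 : x.word = x'.word := by
        rw [word_mul, word_mul, h1] at h
        exact append_cancel_right h
      rw [ihx hs.1 ht.1 h2, ihy hs.2.1 ht.2.1 h1]

theorem exists_isStandard {w : List α} (hw : w.IsLyndon) :
    ∃ t : FreeMagma α, t.IsStandard ∧ t.word = w := by
  induction hn : w.length using Nat.strong_induction_on generalizing w with
  | _ n ih =>
  subst hn
  rcases Nat.lt_or_ge w.length 2 with h | h
  · have h1 : w.length = 1 := by
      have := length_pos_iff.2 hw.1
      omega
    obtain ⟨a, rfl⟩ := length_eq_one_iff.1 h1
    exact ⟨of a, trivial, rfl⟩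
  · obtain ⟨u, v, rfl, hu, hv, hmin⟩ := exists_least_suffix h
    have hul := length_pos_iff.2 hu
    have hvl := length_pos_iff.2 hv
    have hvL := IsLyndon.of_least_suffix_right hu hv hmin
    have huL := hw.of_least_suffix_left hu hv hmin
    obtain ⟨x, hx, rfl⟩ := ih u.length (by rw [length_append]; omega) huL rfl
    obtain ⟨y, hy, rfl⟩ := ih v.length (by rw [length_append]; omega) hvL rfl
    refine ⟨x * y, ⟨hx, hy, ?_, ?_⟩, rfl⟩
    · exact (lt_append_of_ne_nil _ hv).trans (hw.2 _ _ rfl hu hv)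
    · rintro x₁ x₂ rfl
      by_contra hlt
      rw [not_le] at hlt
      have h1 := hmin x₁.word (x₂.word ++ y.word) (by simp) x₁.word_ne_nil (by simp [hv])
      -- If `y = x₂ r` as words, minimality `y ≤ x₂ y` cancels to `r ≤ y`, impossible for the proper
      -- suffix `r` of the Lyndon word `y`.
      rcases exists_append_or_forall_append_lt hlt with ⟨r, hr, hyr⟩ | H
      · rw [hyr, append_le_append_iff_left, ← hyr] at h1
        exact absurd (hvL.2 _ _ hyr x₂.word_ne_nil hr) (not_lt.2 h1)
      · exact absurd (H y.word []) (by simpa using h1)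

end FreeMagma

/-! ### Commutator calculus modulo terms of higher weight. -/

namespace LowerCentral

variable {G : Type*} [Group G]

theorem antitone_lowerCentralTerm : Antitone (lowerCentralTerm G) := fun _ _ h =>
  Subgroup.lowerCentralSeries_antitone _ (Nat.sub_le_sub_right h 1)

theorem conj_mem {i : ℕ} {x : G} (hx : x ∈ lowerCentralTerm G i) (g : G) :
    g * x * g⁻¹ ∈ lowerCentralTerm G i :=
  (lowerCentralTerm_normal G i).conj_mem x hx g

theorem commutator_mem_succ {i : ℕ} {x : G} (hx : x ∈ lowerCentralTerm G i) (y : G) :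
    ⁅x, y⁆ ∈ lowerCentralTerm G (i + 1) :=
  commutator_mem_lowerCentralTerm_succ G i hx y

theorem commutator_mem_swap {S : Subgroup G} {x y : G} : ⁅x, y⁆ ∈ S ↔ ⁅y, x⁆ ∈ S := by
  rw [← commutatorElement_inv, inv_mem_iff]

/-- `[γ_m(G), γ_n(G)] ≤ γ_{m+n}(G)`. -/
theorem commutator_mem_add {m n : ℕ} (hm : 1 ≤ m) (hn : 1 ≤ n) {x y : G}
    (hx : x ∈ lowerCentralTerm G m) (hy : y ∈ lowerCentralTerm G n) :
    ⁅x, y⁆ ∈ lowerCentralTerm G (m + n) := by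
  induction n, hn using Nat.le_induction generalizing m x y with
  | base => exact commutator_mem_succ hx y
  | succ n hn ih =>
    rw [lowerCentralTerm_succ G hn] at hy
    induction hy using Subgroup.closure_induction with
    | mem y hy =>
      obtain ⟨p, hp, r, -, rfl⟩ := hy
      -- Conjugating `x` beforehand makes the conjugate in the Hall–Witt identity equal to `x`
      -- itself.
      have hx' : r⁻¹ * x * r ∈ lowerCentralTerm G m := by simpa using conj_mem hx r⁻¹
      have key := commutatorElement_commutatorElement_conj_mul p r (r⁻¹ * x * r)
      have e : r * (r⁻¹ * x * r) * r⁻¹ = x := by group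
      rw [e, mul_assoc, mul_eq_one_iff_eq_inv] at key
      rw [commutator_mem_swap, key]
      refine inv_mem (mul_mem ?_ ?_)
      · rw [show m + (n + 1) = m + 1 + n by omega]
        refine ih (by omega) ?_ (conj_mem hp _)
        rw [commutator_mem_swap]
        exact commutator_mem_succ hx' r
      · exact commutator_mem_succ (ih hm hx' hp) _
    | one => simp
    | mul y z _ _ hy hz =>
      rw [commutatorElement_mul_right_eq_mul_conj, mul_assoc, mul_assoc, ← mul_assoc y]
      exact mul_mem hy (conj_mem hz y)
    | inv y _ hy =>
      rw [commutatorElement_inv_right]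
      simpa using conj_mem (commutator_mem_swap.1 hy) y⁻¹

/-- γ_k is central modulo γ_{k+1}: conjugation by `g` multiplies `z` by `⁅g, z⁆ ∈ S`. -/
theorem conj_mem_iff {S : Subgroup G} {k : ℕ} (hS : lowerCentralTerm G (k + 1) ≤ S) {z : G}
    (hz : z ∈ lowerCentralTerm G k) (g : G) : g * z * g⁻¹ ∈ S ↔ z ∈ S := by
  have h : ⁅g, z⁆ ∈ S := hS (commutator_mem_swap.1 (commutator_mem_succ hz g))
  rw [show g * z * g⁻¹ = ⁅g, z⁆ * z by simp [commutatorElement_def]]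
  exact Subgroup.mul_mem_cancel_left S h

/-- The elements of `γ_m(G)` whose commutator with `y ∈ γ_n(G)` lies in `S ≥ γ_{m+n+1}(G)`. -/
def bracketInto (m n : ℕ) (hm : 1 ≤ m) (hn : 1 ≤ n) (S : Subgroup G)
    (hS : lowerCentralTerm G (m + n + 1) ≤ S) (y : G) (hy : y ∈ lowerCentralTerm G n) :
    Subgroup G where
  carrier := {x | x ∈ lowerCentralTerm G m ∧ ⁅x, y⁆ ∈ S}
  one_mem' := by simp
  mul_mem' := by
    rintro a b ⟨ha, ha'⟩ ⟨hb, hb'⟩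
    refine ⟨mul_mem ha hb, ?_⟩
    rw [commutatorElement_mul_left_eq_conj_mul]
    exact mul_mem ((conj_mem_iff hS (commutator_mem_add hm hn hb hy) a).2 hb') ha'
  inv_mem' := by
    rintro a ⟨ha, ha'⟩
    refine ⟨inv_mem ha, ?_⟩
    rw [commutatorElement_inv_left]
    have h := (conj_mem_iff hS (z := ⁅y, a⁆) (by
      rw [commutator_mem_swap]
      exact commutator_mem_add hm hn ha hy) a⁻¹).2 (commutator_mem_swap.1 ha')
    simpa using h

theorem commutator_mem_of_mem_sup_left {m n : ℕ} (hm : 1 ≤ m) (hn : 1 ≤ n) {S : Subgroup G}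
    (hS : lowerCentralTerm G (m + n + 1) ≤ S) {A : Set G} (hA : A ⊆ lowerCentralTerm G m) {y : G}
    (hy : y ∈ lowerCentralTerm G n) (h : ∀ a ∈ A, ⁅a, y⁆ ∈ S) {x : G}
    (hx : x ∈ lowerCentralTerm G (m + 1) ⊔ Subgroup.closure A) : ⁅x, y⁆ ∈ S := by
  have hle : lowerCentralTerm G (m + 1) ⊔ Subgroup.closure A ≤
      bracketInto m n hm hn S hS y hy := by
    refine sup_le (fun z hz => ⟨antitone_lowerCentralTerm (Nat.le_succ m) hz, hS ?_⟩) ?_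
    · rw [show m + n + 1 = m + 1 + n by omega]
      exact commutator_mem_add (by omega) hn hz hy
    · exact (Subgroup.closure_le _).2 fun a ha => ⟨hA ha, h a ha⟩
  exact (hle hx).2

theorem sup_closure_le {m : ℕ} {A : Set G} (hA : A ⊆ lowerCentralTerm G m) :
    lowerCentralTerm G (m + 1) ⊔ Subgroup.closure A ≤ lowerCentralTerm G m :=
  sup_le (antitone_lowerCentralTerm (Nat.le_succ m)) ((Subgroup.closure_le _).2 hA)

/-- The commutator is bilinear modulo terms of higher weight. -/
theorem commutator_mem_of_mem_sup {m n : ℕ} (hm : 1 ≤ m) (hn : 1 ≤ n) {S : Subgroup G}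
    (hS : lowerCentralTerm G (m + n + 1) ≤ S) {A B : Set G} (hA : A ⊆ lowerCentralTerm G m)
    (hB : B ⊆ lowerCentralTerm G n) (h : ∀ a ∈ A, ∀ b ∈ B, ⁅a, b⁆ ∈ S) {x y : G}
    (hx : x ∈ lowerCentralTerm G (m + 1) ⊔ Subgroup.closure A)
    (hy : y ∈ lowerCentralTerm G (n + 1) ⊔ Subgroup.closure B) : ⁅x, y⁆ ∈ S := by
  refine commutator_mem_of_mem_sup_left hm hn hS hA (sup_closure_le hB hy) (fun a ha => ?_) hx
  rw [commutator_mem_swap]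
  refine commutator_mem_of_mem_sup_left hn hm (by rwa [add_comm n m]) hB (hA ha)
    (fun b hb => ?_) hy
  rw [commutator_mem_swap]
  exact h a ha b hb

/-- This removes the conjugations from the Hall–Witt identity, leaving the Jacobi identity. -/
theorem commutator_conj_right_mem_iff {m n : ℕ} (hm : 1 ≤ m) (hn : 1 ≤ n) {S : Subgroup G}
    (hS : lowerCentralTerm G (m + n + 1) ≤ S) {x y : G} (hx : x ∈ lowerCentralTerm G m)
    (hy : y ∈ lowerCentralTerm G n) (g : G) : ⁅x, g * y * g⁻¹⁆ ∈ S ↔ ⁅x, y⁆ ∈ S := by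
  have hS' : lowerCentralTerm G (n + m + 1) ≤ S := by rwa [add_comm n m]
  have hle : lowerCentralTerm G (n + 1) ≤ bracketInto n m hn hm S hS' x hx := fun z hz =>
    ⟨antitone_lowerCentralTerm (Nat.le_succ n) hz, hS' (by
      rw [show n + m + 1 = n + 1 + m by omega]
      exact commutator_mem_add (by omega) hm hz hx)⟩
  have key := conj_mem_iff hle hy g
  rw [commutator_mem_swap, commutator_mem_swap (x := x)]
  exact ⟨fun h => (key.1 ⟨conj_mem hy g, h⟩).2, fun h => (key.2 ⟨hy, h⟩).2⟩

/-- The Jacobi identity modulo terms of higher weight. -/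
theorem commutator_commutator_mem {a b c : ℕ} (ha : 1 ≤ a) (hb : 1 ≤ b) (hc : 1 ≤ c)
    {S : Subgroup G} (hS : lowerCentralTerm G (a + b + c + 1) ≤ S) {x y z : G}
    (hx : x ∈ lowerCentralTerm G a) (hy : y ∈ lowerCentralTerm G b)
    (hz : z ∈ lowerCentralTerm G c) (h₁ : ⁅⁅y, z⁆, x⁆ ∈ S) (h₂ : ⁅⁅z, x⁆, y⁆ ∈ S) :
    ⁅⁅x, y⁆, z⁆ ∈ S := by
  have key := commutatorElement_commutatorElement_conj_mul x y z
  rw [mul_assoc, mul_eq_one_iff_eq_inv] at key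
  rw [← commutator_conj_right_mem_iff (by omega) hc hS (commutator_mem_add ha hb hx hy) hz y, key]
  refine inv_mem (mul_mem ?_ ?_)
  · rwa [commutator_conj_right_mem_iff (by omega) ha (le_trans (by
      rw [show b + c + a = a + b + c by omega]) hS) (commutator_mem_add hb hc hy hz) hx z]
  · rwa [commutator_conj_right_mem_iff (by omega) hb (le_trans (by
      rw [show c + a + b = a + b + c by omega]) hS) (commutator_mem_add hc ha hz hx) hy x]

end LowerCentral

/-! ### Standard commutators generate the lower central factors. -/

namespace FreeMagma

open LowerCentral

variable {α G : Type*} [Group G] (f : α → G)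

/-- The iterated group commutator with the bracketing prescribed by a binary tree. -/
def commutator : FreeMagma α → G
  | .of a => f a
  | .mul x y => ⁅commutator x, commutator y⁆

@[simp] theorem commutator_mul (x y : FreeMagma α) :
    commutator f (x * y) = ⁅commutator f x, commutator f y⁆ := rfl

theorem commutator_mem (t : FreeMagma α) : t.commutator f ∈ lowerCentralTerm G t.length := by
  induction t with
  | ih1 a => exact Subgroup.mem_top _
  | ih2 x y hx hy => exact commutator_mem_add x.length_pos y.length_pos hx hy

variable [LinearOrder α]

/-- The commutators of weight `n` given by standard bracketings of words in `P`. -/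
def standardCommutators (n : ℕ) (P : Set (List α)) : Set G :=
  {g | ∃ t : FreeMagma α, t.IsStandard ∧ t.length = n ∧ t.word ∈ P ∧ t.commutator f = g}

/-- The subgroup generated by `γ_{n+1}(G)` and the standard commutators of weight `n`. -/
def standardSpan (n : ℕ) (P : Set (List α)) : Subgroup G :=
  lowerCentralTerm G (n + 1) ⊔ Subgroup.closure (standardCommutators f n P)

theorem standardCommutators_subset (n : ℕ) (P : Set (List α)) :
    standardCommutators f n P ⊆ lowerCentralTerm G n := by
  rintro _ ⟨t, -, rfl, -, rfl⟩
  exact t.commutator_mem f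

theorem le_standardSpan (n : ℕ) (P : Set (List α)) :
    lowerCentralTerm G (n + 1) ≤ standardSpan f n P := le_sup_left

theorem standardSpan_mono (n : ℕ) {P Q : Set (List α)} (h : P ⊆ Q) :
    standardSpan f n P ≤ standardSpan f n Q :=
  sup_le_sup_left (Subgroup.closure_mono (by
    rintro _ ⟨t, h₁, h₂, h₃, h₄⟩
    exact ⟨t, h₁, h₂, h h₃, h₄⟩)) _

variable {f} in
theorem IsStandard.commutator_mem_standardSpan {t : FreeMagma α} (ht : t.IsStandard)
    {P : Set (List α)} (hP : t.word ∈ P) : t.commutator f ∈ standardSpan f t.length P :=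
  Subgroup.mem_sup_right (Subgroup.subset_closure ⟨t, ht, rfl, hP, rfl⟩)

variable {f} in
-- Double induction, on the weight and then on the word of `y`. If `x * y` is not standard, then `x
-- = x₁ * x₂` with `x₁ < x₂ < y` as words, and Jacobi reduces to `⁅⁅x₂, y⁆, x₁⁆` and `⁅⁅y, x₁⁆,
-- x₂⁆`. By lower weight the inner brackets reduce to standard commutators with words below that of
-- `y`. The bound `Set.Iio y.word` is what makes the second induction apply to them.
theorem commutator_mem_standardSpan_of_lt [Finite α] {n : ℕ} {x y : FreeMagma α}
    (hx : x.IsStandard) (hy : y.IsStandard) (hn : x.length + y.length = n)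
    (hxy : x.word < y.word) :
    ⁅x.commutator f, y.commutator f⁆ ∈ standardSpan f n (Set.Iio y.word) := by
  induction n using Nat.strong_induction_on generalizing x y with
  | _ n ihn =>
  -- The lexicographic order on all words need not be well founded (b > ab > aab > ...), but only
  -- finitely many words have length at most `n`.
  have hwf : {l : List α | l.length ≤ n}.WellFoundedOn (· < ·) :=
    (List.finite_length_le α n).wellFoundedOn
  suffices H : ∀ B ∈ {l : List α | l.length ≤ n}, ∀ x y : FreeMagma α, x.IsStandard →
      y.IsStandard → x.length + y.length = n → x.word < y.word → B = y.word →
      ⁅x.commutator f, y.commutator f⁆ ∈ standardSpan f n (Set.Iio y.word) from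
    H y.word (by simp only [Set.mem_ofPred_eq, length_word]; omega) x y hx hy hn hxy rfl
  clear hxy hn hx hy x y
  refine fun B hB => hwf.induction hB (P := fun B => ∀ x y : FreeMagma α, x.IsStandard →
      y.IsStandard → x.length + y.length = n → x.word < y.word → B = y.word →
      ⁅x.commutator f, y.commutator f⁆ ∈ standardSpan f n (Set.Iio y.word)) ?_
  rintro _ hmemB ihB x y hx hy hn hxy rfl
  by_cases hstd : ∀ x₁ x₂, x = x₁ * x₂ → y.word ≤ x₂.word
  · have ht : (x * y).IsStandard := ⟨hx, hy, hxy, hstd⟩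
    have := ht.commutator_mem_standardSpan (f := f) (P := Set.Iio y.word)
      (hy.isLyndon.append_lt x.word_ne_nil hxy)
    rwa [length_mul, hn] at this
  · push Not at hstd
    obtain ⟨x₁, x₂, rfl, h₂⟩ := hstd
    have h₁ : x₁.word < y.word := hx.2.2.1.trans h₂
    have p₁ := x₁.length_pos
    have p₂ := x₂.length_pos
    have py := y.length_pos
    rw [length_mul] at hn
    have hgen : ∀ u v : FreeMagma α, u.IsStandard → v.IsStandard → u.length + v.length = n →
        u.word < y.word → v.word < y.word →
        ⁅u.commutator f, v.commutator f⁆ ∈ standardSpan f n (Set.Iio y.word) := by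
      intro u v hu hv huv hu' hv'
      rcases lt_trichotomy u.word v.word with h | h | h
      · refine standardSpan_mono f n (Set.Iio_subset_Iio hv'.le)
          (ihB v.word ?_ hv' u v hu hv huv h rfl)
        simp only [Set.mem_ofPred_eq, length_word]
        omega
      · rw [hu.word_injective hv h]
        simp
      · rw [commutator_mem_swap]
        refine standardSpan_mono f n (Set.Iio_subset_Iio hu'.le)
          (ihB u.word ?_ hu' v u hv hu (by omega) h rfl)
        simp only [Set.mem_ofPred_eq, length_word]
        omega
    have hstep : ∀ u v : FreeMagma α, u.IsStandard → v.IsStandard →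
        u.length + (v.length + y.length) = n → u.word < y.word →
        ∀ g ∈ standardSpan f (v.length + y.length) (Set.Iio y.word),
        ⁅g, u.commutator f⁆ ∈ standardSpan f n (Set.Iio y.word) := by
      intro u v hu hv hn' hu' g hg
      have pu := u.length_pos
      refine commutator_mem_of_mem_sup_left (m := v.length + y.length) (by omega) pu ?_
        (standardCommutators_subset f (v.length + y.length) (Set.Iio y.word))
        (u.commutator_mem f) ?_ hg
      · rw [show v.length + y.length + u.length = n by omega]
        exact le_standardSpan f n _
      · rintro _ ⟨t, ht, htn, hty, rfl⟩
        exact hgen t u ht hu (by omega) hty hu'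
    refine commutator_commutator_mem p₁ p₂ py ?_ (x₁.commutator_mem f) (x₂.commutator_mem f)
      (y.commutator_mem f)
      (hstep x₁ x₂ hx.1 hx.2.1 (by omega) h₁ _ (ihn _ (by omega) hx.2.1 hy rfl h₂))
      (hstep x₂ x₁ hx.2.1 hx.1 (by omega) h₂ _
        (commutator_mem_swap.1 (ihn _ (by omega) hx.1 hy rfl h₁)))
    rw [hn]
    exact le_standardSpan f n _

/-- If `f` generates `G`, then `γ_n(G)` is generated modulo `γ_{n+1}(G)` by the standard
commutators of weight `n`. -/
theorem lowerCentralTerm_eq_standardSpan [Finite α] (hf : Subgroup.closure (Set.range f) = ⊤)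
    {n : ℕ} (hn : 1 ≤ n) : lowerCentralTerm G n = standardSpan f n Set.univ := by
  refine le_antisymm ?_ (sup_closure_le (standardCommutators_subset f n _))
  have h1 : (⊤ : Subgroup G) ≤ standardSpan f 1 Set.univ := by
    rw [← hf, Subgroup.closure_le]
    rintro _ ⟨a, rfl⟩
    exact IsStandard.commutator_mem_standardSpan (t := of a) trivial (Set.mem_univ _)
  induction n, hn using Nat.le_induction with
  | base => exact h1
  | succ n hn ih =>
    rw [lowerCentralTerm_succ G hn, Subgroup.commutator_le]
    intro x hx y hy
    refine commutator_mem_of_mem_sup hn le_rfl (le_standardSpan f (n + 1) _)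
      (standardCommutators_subset f n _) (standardCommutators_subset f 1 _) ?_ (ih hx) (h1 hy)
    rintro _ ⟨s, hs, hsn, -, rfl⟩ _ ⟨t, ht, htn, -, rfl⟩
    rcases lt_trichotomy s.word t.word with h | h | h
    · exact standardSpan_mono f _ (Set.subset_univ _)
        (commutator_mem_standardSpan_of_lt hs ht (by omega) h)
    · rw [hs.word_injective ht h]
      simp
    · rw [commutator_mem_swap]
      exact standardSpan_mono f _ (Set.subset_univ _)
        (commutator_mem_standardSpan_of_lt ht hs (by omega) h)

end FreeMagma

/-! ### Leading terms of units of a power series ring. -/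

namespace PowerSeries

variable {R : Type*} [Ring R]

/-- `u = 1 + a Xⁿ + (terms of higher order)`. -/
def HasLead (u : (R⟦X⟧)ˣ) (n : ℕ) (a : R) : Prop :=
  ∃ p : R⟦X⟧, (u : R⟦X⟧) = 1 + X ^ n * p ∧ constantCoeff p = a

theorem hasLead_one (n : ℕ) : HasLead (1 : (R⟦X⟧)ˣ) n 0 := ⟨0, by simp, by simp⟩

theorem HasLead.coeff_eq {u : (R⟦X⟧)ˣ} {n : ℕ} {a : R} (h : HasLead u n a) (hn : 1 ≤ n) :
    coeff n (u : R⟦X⟧) = a := by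
  obtain ⟨p, hp, rfl⟩ := h
  have h0 : n ≠ 0 := by omega
  rw [hp, map_add, coeff_one, if_neg h0, zero_add]
  simpa using coeff_X_pow_mul p n 0

theorem HasLead.constantCoeff_eq {u : (R⟦X⟧)ˣ} {n : ℕ} {a : R} (h : HasLead u n a) (hn : 1 ≤ n) :
    constantCoeff (u : R⟦X⟧) = 1 := by
  obtain ⟨p, hp, rfl⟩ := h
  have h0 : n ≠ 0 := by omega
  simp [hp, h0]

theorem constantCoeff_units_inv {u : (R⟦X⟧)ˣ} (h : constantCoeff (u : R⟦X⟧) = 1) :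
    constantCoeff ((u⁻¹ : (R⟦X⟧)ˣ) : R⟦X⟧) = 1 := by
  have := congrArg constantCoeff u.mul_inv
  rwa [map_mul, h, one_mul, map_one] at this

theorem HasLead.mul {u v : (R⟦X⟧)ˣ} {n : ℕ} {a b : R} (hu : HasLead u n a) (hv : HasLead v n b)
    (hn : 1 ≤ n) : HasLead (u * v) n (a + b) := by
  have hv1 := hv.constantCoeff_eq hn
  obtain ⟨p, hp, rfl⟩ := hu
  obtain ⟨r, hr, rfl⟩ := hv
  refine ⟨p * v + r, ?_, ?_⟩
  · rw [Units.val_mul, hp, add_mul, one_mul, mul_add, mul_assoc]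
    nth_rw 1 [hr]
    abel
  · simp [hv1]

theorem HasLead.inv {u : (R⟦X⟧)ˣ} {n : ℕ} {a : R} (hu : HasLead u n a) (hn : 1 ≤ n) :
    HasLead u⁻¹ n (-a) := by
  have hu1 := constantCoeff_units_inv (hu.constantCoeff_eq hn)
  obtain ⟨p, hp, rfl⟩ := hu
  refine ⟨-(p * (u⁻¹ : (R⟦X⟧)ˣ)), ?_, by simp [hu1]⟩
  have h : (1 + X ^ n * p) * ((u⁻¹ : (R⟦X⟧)ˣ) : R⟦X⟧) = 1 := by rw [← hp, u.mul_inv]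
  rw [add_mul, one_mul, mul_assoc] at h
  rw [mul_neg, ← sub_eq_add_neg]
  exact eq_sub_of_add_eq h

theorem HasLead.of_succ {u : (R⟦X⟧)ˣ} {n : ℕ} {a : R} (h : HasLead u (n + 1) a) :
    HasLead u n 0 := by
  obtain ⟨p, hp, -⟩ := h
  exact ⟨X * p, by rw [hp, pow_succ, mul_assoc], by simp⟩

/-- `⁅u, v⁆ - 1 = (uv - vu) u⁻¹ v⁻¹`, and since `X` is central `uv - vu = X ^ (m + n) * (p * r - r *
p)`. -/
theorem HasLead.commutator {u v : (R⟦X⟧)ˣ} {m n : ℕ} {a b : R} (hu : HasLead u m a)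
    (hv : HasLead v n b) (hm : 1 ≤ m) (hn : 1 ≤ n) :
    HasLead ⁅u, v⁆ (m + n) (a * b - b * a) := by
  have hu1 := constantCoeff_units_inv (hu.constantCoeff_eq hm)
  have hv1 := constantCoeff_units_inv (hv.constantCoeff_eq hn)
  obtain ⟨p, hp, rfl⟩ := hu
  obtain ⟨r, hr, rfl⟩ := hv
  refine ⟨(p * r - r * p) * ((u⁻¹ : (R⟦X⟧)ˣ) * (v⁻¹ : (R⟦X⟧)ˣ)), ?_, by simp [hu1, hv1]⟩
  have hc : (u : R⟦X⟧) * (v : R⟦X⟧) = (v : R⟦X⟧) * (u : R⟦X⟧) + X ^ (m + n) * (p * r - r * p) := by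
    have h1 : X ^ m * p * (X ^ n * r) = X ^ (m + n) * (p * r) := by
      rw [mul_assoc, ← mul_assoc p, ← X_pow_mul, pow_add]
      simp only [mul_assoc]
    have h2 : X ^ n * r * (X ^ m * p) = X ^ (m + n) * (r * p) := by
      rw [mul_assoc, ← mul_assoc r, ← X_pow_mul, add_comm m n, pow_add]
      simp only [mul_assoc]
    rw [hp, hr, mul_sub, ← h1, ← h2]
    noncomm_ring
  have hi : (v * u : R⟦X⟧) * ((u⁻¹ : (R⟦X⟧)ˣ) * (v⁻¹ : (R⟦X⟧)ˣ)) = 1 := by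
    rw [mul_assoc, ← mul_assoc (u : R⟦X⟧), u.mul_inv, one_mul, v.mul_inv]
  rw [commutatorElement_def, Units.val_mul, Units.val_mul, Units.val_mul, mul_assoc, hc, add_mul,
    hi, mul_assoc]

/-- The unit `1 + a X`. -/
noncomputable def oneAddMulX (a : R) : (R⟦X⟧)ˣ where
  val := 1 + X * C a
  inv := mk fun n => (-a) ^ n
  val_inv := by
    ext n
    cases n with
    | zero => simp
    | succ n =>
      rw [add_mul, one_mul, map_add, mul_assoc, coeff_succ_X_mul, coeff_C_mul, coeff_mk, coeff_mk,
        pow_succ', coeff_one, if_neg n.succ_ne_zero]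
      simp
  inv_val := by
    ext n
    cases n with
    | zero => simp
    | succ n =>
      rw [mul_add, mul_one, map_add, ← (commute_X (C a)).eq, ← mul_assoc, coeff_succ_mul_X,
        coeff_mul_C, coeff_mk, coeff_mk, pow_succ, coeff_one, if_neg n.succ_ne_zero]
      simp

theorem hasLead_oneAddMulX (a : R) : HasLead (oneAddMulX a) 1 a :=
  ⟨C a, by simp [oneAddMulX], by simp⟩

section LowerCentral

variable {G : Type*} [Group G] (M : G →* (R⟦X⟧)ˣ)

theorem exists_hasLead (hM : ∀ g, ∃ a, HasLead (M g) 1 a) {n : ℕ} (hn : 1 ≤ n) {g : G}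
    (hg : g ∈ lowerCentralTerm G n) : ∃ a, HasLead (M g) n a := by
  induction n, hn using Nat.le_induction generalizing g with
  | base => exact hM g
  | succ n hn ih =>
    rw [lowerCentralTerm_succ G hn] at hg
    induction hg using Subgroup.closure_induction with
    | mem g hg =>
      obtain ⟨x, hx, y, -, rfl⟩ := hg
      obtain ⟨a, ha⟩ := ih hx
      obtain ⟨b, hb⟩ := hM y
      rw [map_commutatorElement]
      exact ⟨_, ha.commutator hb hn le_rfl⟩
    | one => exact ⟨0, by simpa using hasLead_one (n + 1)⟩
    | mul x y _ _ hx hy =>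
      obtain ⟨a, ha⟩ := hx
      obtain ⟨b, hb⟩ := hy
      rw [map_mul]
      exact ⟨_, ha.mul hb (by omega)⟩
    | inv x _ hx =>
      obtain ⟨a, ha⟩ := hx
      rw [map_inv]
      exact ⟨_, ha.inv (by omega)⟩

/-- The leading coefficient of the Magnus expansion on the lower central factor of weight `n`. -/
noncomputable def leadHom (hM : ∀ g, ∃ a, HasLead (M g) 1 a) {n : ℕ} (hn : 1 ≤ n) :
    Additive (LowerCentralFactor G n) →+ R :=
  MonoidHom.toAdditiveLeft <| QuotientGroup.lift _
    { toFun := fun g : lowerCentralTerm G n => Multiplicative.ofAdd (coeff n (M g : R⟦X⟧))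
      map_one' := by
        have h0 : n ≠ 0 := by omega
        simp [coeff_one, h0]
      map_mul' := fun g h => by
        obtain ⟨a, ha⟩ := exists_hasLead M hM hn g.2
        obtain ⟨b, hb⟩ := exists_hasLead M hM hn h.2
        rw [← ofAdd_add, Subgroup.coe_mul, map_mul, (ha.mul hb hn).coeff_eq hn, ha.coeff_eq hn,
          hb.coeff_eq hn] }
    (fun g hg => by
      rw [Subgroup.mem_subgroupOf] at hg
      obtain ⟨a, ha⟩ := exists_hasLead M hM (Nat.le_succ_of_le hn) hg
      rw [MonoidHom.mem_ker]
      exact congrArg Multiplicative.ofAdd (ha.of_succ.coeff_eq hn))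

end LowerCentral

end PowerSeries

/-! ### Triangularity and independence of the Lie polynomials. -/

namespace FreeMagma

open PowerSeries

variable {α : Type*}

/-- The iterated ring commutator with the bracketing prescribed by a binary tree. -/
def liePoly {R : Type*} [Ring R] (f : α → R) : FreeMagma α → R
  | .of a => f a
  | .mul x y => liePoly f x * liePoly f y - liePoly f y * liePoly f x

theorem liePoly_mul {R : Type*} [Ring R] (f : α → R) (x y : FreeMagma α) :
    liePoly f (x * y) = liePoly f x * liePoly f y - liePoly f y * liePoly f x := rfl

theorem hasLead_commutator {R G : Type*} [Ring R] [Group G] {f : α → R} {g : α → G}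
    {M : G →* (R⟦X⟧)ˣ} (h : ∀ a, HasLead (M (g a)) 1 (f a)) (t : FreeMagma α) :
    HasLead (M (t.commutator g)) t.length (t.liePoly f) := by
  induction t with
  | ih1 a => exact h a
  | ih2 x y hx hy =>
    rw [commutator_mul, map_commutatorElement]
    exact hx.commutator hy x.length_pos y.length_pos

/-- The monomial of a word in the free associative ring. -/
noncomputable def wordMonomial (w : List α) : MonoidAlgebra ℤ (FreeMonoid α) :=
  MonoidAlgebra.single (FreeMonoid.ofList w) 1

theorem wordMonomial_mul (u v : List α) :
    wordMonomial u * wordMonomial v = wordMonomial (u ++ v) := by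
  simp [wordMonomial, MonoidAlgebra.single_mul_single]

/-- The span of the monomials of the words in `P`. -/
noncomputable def wordSpan (P : Set (List α)) : Submodule ℤ (MonoidAlgebra ℤ (FreeMonoid α)) :=
  Submodule.span ℤ (wordMonomial '' P)

theorem wordMonomial_mem {P : Set (List α)} {w : List α} (hw : w ∈ P) :
    wordMonomial w ∈ wordSpan P := Submodule.subset_span ⟨w, hw, rfl⟩

theorem wordSpan_mono {P Q : Set (List α)} (h : P ⊆ Q) : wordSpan P ≤ wordSpan Q :=
  Submodule.span_mono (Set.image_mono h)

theorem mul_mem_wordSpan {P Q T : Set (List α)} {a b : MonoidAlgebra ℤ (FreeMonoid α)}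
    (ha : a ∈ wordSpan P) (hb : b ∈ wordSpan Q) (h : ∀ u ∈ P, ∀ v ∈ Q, u ++ v ∈ T) :
    a * b ∈ wordSpan T := by
  have hab := Submodule.mul_mem_mul ha hb
  rw [wordSpan, wordSpan, Submodule.span_mul_span] at hab
  refine Submodule.span_mono ?_ hab
  rintro _ ⟨_, ⟨u, hu, rfl⟩, _, ⟨v, hv, rfl⟩, rfl⟩
  exact ⟨u ++ v, h u hu v hv, (wordMonomial_mul u v).symm⟩

/-- The coefficient of a word. -/
noncomputable def wordCoeff (w : List α) : MonoidAlgebra ℤ (FreeMonoid α) →ₗ[ℤ] ℤ :=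
  Finsupp.lapply (FreeMonoid.ofList w) ∘ₗ (MonoidAlgebra.coeffLinearEquiv ℤ).toLinearMap

theorem wordCoeff_wordMonomial (v w : List α) : wordCoeff w (wordMonomial v) =
    Finsupp.single (FreeMonoid.ofList v) (1 : ℤ) (FreeMonoid.ofList w) := rfl

theorem wordCoeff_wordMonomial_self (w : List α) : wordCoeff w (wordMonomial w) = 1 := by
  rw [wordCoeff_wordMonomial, Finsupp.single_eq_same]

theorem wordCoeff_wordMonomial_of_ne {v w : List α} (h : v ≠ w) :
    wordCoeff w (wordMonomial v) = 0 := by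
  rw [wordCoeff_wordMonomial, Finsupp.single_eq_of_ne]
  exact fun e => h (FreeMonoid.ofList.injective e).symm

theorem wordCoeff_eq_zero {P : Set (List α)} {w : List α} (hw : w ∉ P)
    {a : MonoidAlgebra ℤ (FreeMonoid α)} (ha : a ∈ wordSpan P) : wordCoeff w a = 0 := by
  have hle : wordSpan P ≤ LinearMap.ker (wordCoeff w) := by
    refine Submodule.span_le.2 ?_
    rintro _ ⟨v, hv, rfl⟩
    exact wordCoeff_wordMonomial_of_ne fun h => hw (h ▸ hv)
  exact hle ha

variable [LinearOrder α]

/-- The Lie polynomial of a standard bracketing is its word plus larger words of the same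
length. -/
theorem IsStandard.liePoly_sub_mem {t : FreeMagma α} (ht : t.IsStandard) :
    t.liePoly (fun a => wordMonomial [a]) - wordMonomial t.word ∈
      wordSpan {w | w.length = t.length ∧ t.word < w} := by
  induction t with
  | ih1 a => simp [liePoly]
  | ih2 x y ihx ihy =>
    have hxy := ht.2.2.1
    have hx := ihx ht.1
    have hy := ihy ht.2.1
    set p := x.liePoly (fun a => wordMonomial [a])
    set r := y.liePoly (fun a => wordMonomial [a])
    have hle : ∀ s : FreeMagma α, s.liePoly (fun a => wordMonomial [a]) - wordMonomial s.word ∈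
        wordSpan {w | w.length = s.length ∧ s.word < w} →
        s.liePoly (fun a => wordMonomial [a]) ∈
          wordSpan {w | w.length = s.length ∧ s.word ≤ w} := fun s hs => by
      have h1 : wordMonomial s.word ∈ wordSpan {w | w.length = s.length ∧ s.word ≤ w} :=
        wordMonomial_mem ⟨s.length_word, le_rfl⟩
      have h2 := wordSpan_mono (Q := {w | w.length = s.length ∧ s.word ≤ w})
        (fun w hw => ⟨hw.1, hw.2.le⟩) hs
      simpa using add_mem h2 h1
    have hconcat : ∀ u v u' v' : List α, u.length = u'.length → u ≤ u' → v ≤ v' →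
        u ++ v ≤ u' ++ v' := fun u v u' v' hl hu hv => by
      rcases hu.eq_or_lt with rfl | hu
      · exact (List.append_le_append_iff_left u).2 hv
      · exact (List.append_lt_append_of_length_eq hu hl v v').le
    have e : (x * y).liePoly (fun a => wordMonomial [a]) - wordMonomial (x * y).word =
        (p - wordMonomial x.word) * r + wordMonomial x.word * (r - wordMonomial y.word) -
          r * p := by
      rw [liePoly_mul, word_mul, ← wordMonomial_mul]
      noncomm_ring
    rw [e]
    refine sub_mem (add_mem (mul_mem_wordSpan hx (hle y hy) ?_)
      (mul_mem_wordSpan (wordMonomial_mem (Set.mem_singleton _)) hy ?_))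
      (mul_mem_wordSpan (hle y hy) (hle x hx) ?_)
    · rintro u ⟨hu, hu'⟩ v ⟨hv, -⟩
      exact ⟨by rw [List.length_append, hu, hv, length_mul],
        List.append_lt_append_of_length_eq hu' (by rw [hu, length_word]) _ _⟩
    · rintro _ rfl v ⟨hv, hv'⟩
      exact ⟨by rw [List.length_append, length_word, hv, length_mul],
        (List.append_lt_append_iff_left _).2 hv'⟩
    -- Words of `r * p` are at least `yx`, and `xy < y < yx` as words.
    · rintro u ⟨hu, hu'⟩ v ⟨hv, hv'⟩
      refine ⟨by rw [List.length_append, hu, hv, length_mul, add_comm], ?_⟩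
      exact ((ht.2.1.isLyndon.append_lt x.word_ne_nil hxy).trans
        (List.lt_append_of_ne_nil _ x.word_ne_nil)).trans_le
        (hconcat _ _ _ _ (by rw [hu, length_word]) hu' hv')

/-- In a relation, take the least `w j` among the nonzero coefficients: no other term contributes to
that word, so its coefficient vanishes. -/
theorem linearIndependent_of_triangular {ι : Type*} {b : ι → MonoidAlgebra ℤ (FreeMonoid α)}
    {w : ι → List α} (hw : Function.Injective w)
    (h : ∀ i, b i - wordMonomial (w i) ∈ wordSpan (Set.Ioi (w i))) : LinearIndependent ℤ b := by
  classical
  rw [linearIndependent_iff']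
  intro s g hg i hi
  by_contra hgi
  obtain ⟨j, hj, hmin⟩ := (s.filter fun i => g i ≠ 0).exists_min_image w
    ⟨i, Finset.mem_filter.2 ⟨hi, hgi⟩⟩
  rw [Finset.mem_filter] at hj
  have hcoeff : ∀ k v, v ≤ w k → wordCoeff v (b k) = wordCoeff v (wordMonomial (w k)) :=
    fun k v hv => by
      have := wordCoeff_eq_zero (w := v) (fun hlt => not_lt.2 hv hlt) (h k)
      rwa [map_sub, sub_eq_zero] at this
  have h0 := congrArg (wordCoeff (w j)) hg
  rw [map_sum, map_zero, Finset.sum_eq_single j] at h0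
  · rw [map_smul, hcoeff j _ le_rfl, wordCoeff_wordMonomial_self] at h0
    exact hj.2 (by simpa using h0)
  · intro k hk hkj
    rw [map_smul]
    by_cases hgk : g k = 0
    · simp [hgk]
    · rw [hcoeff k _ (hmin k (Finset.mem_filter.2 ⟨hk, hgk⟩)),
        wordCoeff_wordMonomial_of_ne (fun e => hkj (hw e)), smul_zero]
  · exact fun hnj => absurd hj.1 hnj

theorem linearIndependent_liePoly (n : ℕ) :
    LinearIndependent ℤ fun t : {t : FreeMagma α // t.IsStandard ∧ t.length = n} =>
      t.1.liePoly fun a => wordMonomial [a] :=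
  linearIndependent_of_triangular (w := fun t => t.1.word)
    (fun s t h => Subtype.ext (s.2.1.word_injective t.2.1 h))
    (fun t => wordSpan_mono (fun _ hw => hw.2) t.2.1.liePoly_sub_mem)

end FreeMagma

/-! ### Counting Lyndon words through periodic sequences. -/

namespace List

variable {α : Type*} [LinearOrder α]

/-- A word is a Lyndon word if and only if it is smaller than its proper rotations. -/
theorem isLyndon_iff_lt_rotation {w : List α} :
    w.IsLyndon ↔ w ≠ [] ∧ ∀ u v, w = u ++ v → u ≠ [] → v ≠ [] → w < v ++ u := by
  refine ⟨fun h => ⟨h.1, fun u v e hu hv =>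
    (h.2 u v e hu hv).trans (lt_append_of_ne_nil v hu)⟩, fun h => ⟨h.1, fun u v e hu hv => ?_⟩⟩
  by_contra hlt
  have hne : v ≠ w := by
    rintro rfl
    exact hu (by simpa using e)
  have hvw : v < w := lt_of_le_of_ne (not_lt.1 hlt) hne
  have hrot := h.2 u v e hu hv
  -- If `w = v ++ t`, then `w < v ++ u` gives `t < u` with equal lengths, so the rotation `t ++ v`
  -- is below `u ++ v = w`.
  rcases exists_append_or_forall_append_lt hvw with ⟨t, ht, hwt⟩ | H
  · have hlen : t.length = u.length := by
      have := congrArg length (e.symm.trans hwt)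
      simp at this
      omega
    have htu : t < u := by
      rw [hwt] at hrot
      exact (append_lt_append_iff_left v).1 hrot
    have := append_lt_append_of_length_eq htu hlen v v
    rw [← e] at this
    exact lt_asymm this (h.2 v t hwt hv ht)
  · exact lt_asymm hrot (by simpa using H u [])

end List

namespace Necklace

open Function

variable {α : Type*}

/-- The shift on sequences. -/
def shift (f : ℕ → α) : ℕ → α := fun k => f (k + 1)

theorem iterate_shift (n : ℕ) (f : ℕ → α) (k : ℕ) : shift^[n] f k = f (k + n) := by
  induction n generalizing k with
  | zero => rfl
  | succ n ih =>
    rw [iterate_succ_apply', shift, ih]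
    congr 1
    omega

/-- The word of the first `d` terms of a sequence. -/
def initial (d : ℕ) (f : ℕ → α) : List α := (List.range d).map f

@[simp] theorem length_initial (d : ℕ) (f : ℕ → α) : (initial d f).length = d := by
  simp [initial]

theorem apply_mod {d : ℕ} {f : ℕ → α} (h : IsPeriodicPt shift d f) (k : ℕ) : f (k % d) = f k := by
  have := congrFun (h.iterate_mod_apply k) 0
  simpa [iterate_shift] using this

theorem initial_injOn {d : ℕ} (hd : 0 < d) {f g : ℕ → α} (hf : IsPeriodicPt shift d f)
    (hg : IsPeriodicPt shift d g) (h : initial d f = initial d g) : f = g := by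
  funext k
  rw [← apply_mod hf, ← apply_mod hg]
  exact List.map_inj_left.1 h _ (List.mem_range.2 (Nat.mod_lt k hd))

theorem initial_iterate_shift {d i : ℕ} {f : ℕ → α} (hf : IsPeriodicPt shift d f) (hi : i ≤ d) :
    initial d (shift^[i] f) = (initial d f).drop i ++ (initial d f).take i := by
  refine List.ext_getElem (by simp [hi]) fun k h₁ h₂ => ?_
  rw [length_initial] at h₁
  rw [List.getElem_append]
  split_ifs with h
  · simp [initial, iterate_shift, add_comm]
  · simp only [List.length_drop, length_initial, not_lt] at h
    simp only [initial, List.getElem_map, List.getElem_range, iterate_shift, List.getElem_take,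
      List.length_drop, List.length_map, List.length_range]
    rw [← apply_mod hf]
    congr 1
    rw [show k + i = k - (d - i) + d by omega, Nat.add_mod_right, Nat.mod_eq_of_lt (by omega)]

/-- The periodic sequence with a given period. -/
def cyclicExtension {d : ℕ} (hd : 0 < d) (g : Fin d → α) : ℕ → α :=
  fun k => g ⟨k % d, Nat.mod_lt k hd⟩

theorem isPeriodicPt_cyclicExtension {d : ℕ} (hd : 0 < d) (g : Fin d → α) :
    IsPeriodicPt shift d (cyclicExtension hd g) := by
  funext k
  simp [iterate_shift, cyclicExtension]

/-- Sequences of period `d` are determined by their first `d` terms. -/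
def periodicEquiv {d : ℕ} (hd : 0 < d) :
    {f : ℕ → α // IsPeriodicPt shift d f} ≃ (Fin d → α) where
  toFun f i := f.1 i
  invFun g := ⟨cyclicExtension hd g, isPeriodicPt_cyclicExtension hd g⟩
  left_inv f := Subtype.ext (funext fun k => apply_mod f.2 k)
  right_inv g := funext fun i => by simp [cyclicExtension, Nat.mod_eq_of_lt i.2]

theorem card_periodic [Finite α] {n : ℕ} (hn : 0 < n) :
    Nat.card {f : ℕ → α // IsPeriodicPt shift n f} = Nat.card α ^ n := by
  rw [Nat.card_congr (periodicEquiv hn), Nat.card_fun, Nat.card_fin]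

theorem finite_minimalPeriod [Finite α] {d : ℕ} (hd : 0 < d) :
    Finite {f : ℕ → α // minimalPeriod shift f = d} := by
  have : Finite {f : ℕ → α // IsPeriodicPt shift d f} := Finite.of_equiv _ (periodicEquiv hd).symm
  refine Finite.of_injective (β := {f : ℕ → α // IsPeriodicPt shift d f})
    (fun f => ⟨f.1, ?_⟩) fun f g h => Subtype.ext (Subtype.mk.inj h)
  have := isPeriodicPt_minimalPeriod shift f.1
  rwa [f.2] at this

theorem sum_card_minimalPeriod [Finite α] {n : ℕ} (hn : 0 < n) :
    ∑ d ∈ n.divisors, Nat.card {f : ℕ → α // minimalPeriod shift f = d} = Nat.card α ^ n := by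
  have : ∀ d : n.divisors, Finite {f : ℕ → α // minimalPeriod shift f = d} := fun d =>
    finite_minimalPeriod (Nat.pos_of_mem_divisors d.2)
  rw [← Finset.sum_coe_sort, ← Nat.card_sigma, ← card_periodic hn]
  refine Nat.card_congr
    { toFun := fun x => ⟨x.2.1, ?_⟩
      invFun := fun f => ⟨⟨minimalPeriod shift f.1, ?_⟩, ⟨f.1, rfl⟩⟩
      left_inv := ?_
      right_inv := fun f => rfl }
  · rw [isPeriodicPt_iff_minimalPeriod_dvd, x.2.2]
    exact Nat.dvd_of_mem_divisors x.1.2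
  · exact Nat.mem_divisors.2 ⟨f.2.minimalPeriod_dvd, hn.ne'⟩
  · rintro ⟨⟨d, hd⟩, ⟨f, hf⟩⟩
    obtain rfl : minimalPeriod shift f = d := hf
    rfl

variable [LinearOrder α]

/-- The sequences of minimal period `d` whose initial word is smaller than those of its shifts. -/
def minimalSequences (α : Type*) [LinearOrder α] (d : ℕ) : Set (ℕ → α) :=
  {f | minimalPeriod shift f = d ∧
    ∀ i, 0 < i → i < d → initial d f < initial d (shift^[i] f)}

theorem isPeriodicPt_of_mem_minimalSequences {d : ℕ} {f : ℕ → α} (hf : f ∈ minimalSequences α d) :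
    IsPeriodicPt shift d f := by
  have := isPeriodicPt_minimalPeriod shift f
  rwa [hf.1] at this

theorem bijOn_initial {d : ℕ} (hd : 0 < d) : Set.BijOn (initial d) (minimalSequences α d)
    {w : List α | w.IsLyndon ∧ w.length = d} := by
  refine ⟨fun f hf => ⟨?_, length_initial d f⟩, fun f hf g hg h => initial_injOn hd
    (isPeriodicPt_of_mem_minimalSequences hf) (isPeriodicPt_of_mem_minimalSequences hg) h, ?_⟩
  · refine List.isLyndon_iff_lt_rotation.2 ⟨?_, fun u v e hu hv => ?_⟩
    · rw [← List.length_pos_iff, length_initial]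
      exact hd
    · have hl := congrArg List.length e
      rw [length_initial, List.length_append] at hl
      have hul := List.length_pos_iff.2 hu
      have hvl := List.length_pos_iff.2 hv
      have h := hf.2 u.length hul (by omega)
      rw [initial_iterate_shift (isPeriodicPt_of_mem_minimalSequences hf) (by omega)] at h
      simpa [e] using h
  · rintro w ⟨hw, rfl⟩
    have hp := isPeriodicPt_cyclicExtension hd (fun i => w[i])
    have hinit : initial w.length (cyclicExtension hd fun i => w[i]) = w := by
      refine List.ext_getElem (by simp) fun k h₁ h₂ => ?_
      simp [initial, cyclicExtension, Nat.mod_eq_of_lt h₂]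
    have hlt : ∀ i, 0 < i → i < w.length →
        initial w.length (cyclicExtension hd fun i => w[i]) <
          initial w.length (shift^[i] (cyclicExtension hd fun i => w[i])) := fun i hi hiw => by
      rw [initial_iterate_shift hp hiw.le, hinit]
      refine (List.isLyndon_iff_lt_rotation.1 hw).2 _ _ (List.take_append_drop i w).symm ?_ ?_
      · rw [← List.length_pos_iff, List.length_take]
        omega
      · rw [← List.length_pos_iff, List.length_drop]
        omega
    refine ⟨_, ⟨?_, hlt⟩, hinit⟩
    -- A shorter period would make some nontrivial rotation equal to the word, contradicting
    -- strictness.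
    by_contra hne
    have hm : minimalPeriod shift (cyclicExtension hd fun i => w[i]) < w.length :=
      lt_of_le_of_ne (hp.minimalPeriod_le hd) hne
    have h := hlt _ (hp.minimalPeriod_pos hd) hm
    rw [iterate_minimalPeriod] at h
    exact lt_irrefl _ h

/-- Every shift orbit of size `d` contains exactly one sequence with least initial word; two
different ones would each be smaller than the other. -/
theorem bijective_shift_minimalSequences {d : ℕ} (hd : 0 < d) :
    Bijective fun x : minimalSequences α d × Fin d =>
      (⟨shift^[x.2] x.1.1, by
        rw [minimalPeriod_apply_iterate
          (mk_mem_periodicPts hd (isPeriodicPt_of_mem_minimalSequences x.1.2)), x.1.2.1]⟩ :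
        {f : ℕ → α // minimalPeriod shift f = d}) := by
  have hback : ∀ {f g : ℕ → α} {k : ℕ}, IsPeriodicPt shift d g → k ≤ d →
      f = shift^[k] g → g = shift^[d - k] f := by
    rintro _ g k hg hk rfl
    rw [← iterate_add_apply, Nat.sub_add_cancel hk]
    exact hg.symm
  constructor
  · rintro ⟨⟨f, hf⟩, i, hi⟩ ⟨⟨g, hg⟩, j, hj⟩ h
    have hfp := isPeriodicPt_of_mem_minimalSequences hf
    have hgp := isPeriodicPt_of_mem_minimalSequences hg
    have h : shift^[i] f = shift^[j] g := congrArg Subtype.val h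
    have hfg : f = shift^[(d - i + j) % d] g := by
      rw [hgp.iterate_mod_apply, iterate_add_apply, ← h]
      exact hback hfp hi.le rfl
    have hk : (d - i + j) % d < d := Nat.mod_lt _ hd
    generalize (d - i + j) % d = k at hfg hk
    rcases Nat.eq_zero_or_pos k with rfl | hk0
    · obtain rfl : f = g := hfg
      have hij : i = j := by
        rwa [iterate_eq_iterate_iff_of_lt_minimalPeriod (by rwa [hf.1]) (by rwa [hf.1])] at h
      subst hij
      rfl
    · have h1 := hg.2 k hk0 hk
      have h2 := hf.2 (d - k) (by omega) (by omega)
      rw [← hfg] at h1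
      rw [← hback hgp hk.le hfg] at h2
      exact absurd h1 (lt_asymm h2)
  · rintro ⟨h, hh⟩
    have hp : IsPeriodicPt shift d h := by
      have := isPeriodicPt_minimalPeriod shift h
      rwa [hh] at this
    obtain ⟨i, hi, hmin⟩ := (Finset.range d).exists_min_image (fun i => initial d (shift^[i] h))
      ⟨0, Finset.mem_range.2 hd⟩
    rw [Finset.mem_range] at hi
    have hper : minimalPeriod shift (shift^[i] h) = d := by
      rw [minimalPeriod_apply_iterate (mk_mem_periodicPts hd hp), hh]
    have hf : shift^[i] h ∈ minimalSequences α d := by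
      refine ⟨hper, fun k hk hkd => lt_of_le_of_ne ?_ fun e => ?_⟩
      · rw [← iterate_add_apply, ← hp.iterate_mod_apply (k + i)]
        exact hmin _ (Finset.mem_range.2 (Nat.mod_lt _ hd))
      · have := initial_injOn hd (hp.apply_iterate i) ((hp.apply_iterate i).apply_iterate k) e
        exact not_isPeriodicPt_of_pos_of_lt_minimalPeriod hk.ne' (by rwa [hper]) this.symm
    -- Shifting by `d - i` undoes the shift by `i`; the reduction modulo `d` matters only for `i =
    -- 0`.
    refine ⟨⟨⟨_, hf⟩, ⟨(d - i) % d, Nat.mod_lt _ hd⟩⟩, Subtype.ext ?_⟩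
    change shift^[(d - i) % d] (shift^[i] h) = h
    rw [(hp.apply_iterate i).iterate_mod_apply]
    exact (hback hp hi.le rfl).symm

/-- The number of Lyndon words of length `d`. -/
noncomputable def lyndonCount (α : Type*) [LinearOrder α] (d : ℕ) : ℕ :=
  {w : List α | w.IsLyndon ∧ w.length = d}.ncard

theorem card_minimalPeriod {d : ℕ} (hd : 0 < d) :
    Nat.card {f : ℕ → α // minimalPeriod shift f = d} = d * lyndonCount α d := by
  rw [← Nat.card_eq_of_bijective _ (bijective_shift_minimalSequences hd), Nat.card_prod,
    Nat.card_fin, mul_comm, lyndonCount, ← Nat.card_coe_set_eq,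
    Nat.card_congr (bijOn_initial hd).equiv]

theorem sum_mul_lyndonCount [Finite α] {n : ℕ} (hn : 0 < n) :
    ∑ d ∈ n.divisors, d * lyndonCount α d = Nat.card α ^ n := by
  rw [← sum_card_minimalPeriod hn]
  exact Finset.sum_congr rfl fun d hd => (card_minimalPeriod (Nat.pos_of_mem_divisors hd)).symm

/-- Witt's formula for the number of Lyndon words. -/
theorem lyndonCount_eq [Finite α] {n : ℕ} (hn : 0 < n) :
    (lyndonCount α n : ℚ) = (1 / (n : ℚ)) *
      ∑ d ∈ n.divisors, (ArithmeticFunction.moebius d : ℚ) * (Nat.card α : ℚ) ^ (n / d) := by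
  -- Möbius inversion of `sum_mul_lyndonCount`.
  have h := (ArithmeticFunction.sum_eq_iff_sum_mul_moebius_eq
    (f := fun d => ((d * lyndonCount α d : ℕ) : ℚ)) (g := fun n => (Nat.card α : ℚ) ^ n)).1
    (fun m hm => by exact_mod_cast sum_mul_lyndonCount (α := α) hm) n hn
  rw [Nat.sum_divisorsAntidiagonal
    (fun d e => (ArithmeticFunction.moebius d : ℚ) * (Nat.card α : ℚ) ^ e)] at h
  rw [h]
  have : (n : ℚ) ≠ 0 := by exact_mod_cast hn.ne'
  push_cast
  field_simp

theorem ncard_isStandard (n : ℕ) :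
    Nat.card {t : FreeMagma α // t.IsStandard ∧ t.length = n} = lyndonCount α n := by
  rw [lyndonCount, ← Nat.card_coe_set_eq]
  refine Nat.card_eq_of_bijective
    (fun t => ⟨t.1.word, t.2.1.isLyndon, by rw [FreeMagma.length_word, t.2.2]⟩)
    ⟨fun s t h => Subtype.ext (s.2.1.word_injective t.2.1 (congrArg Subtype.val h)), ?_⟩
  rintro ⟨w, hw, hn⟩
  obtain ⟨t, ht, rfl⟩ := FreeMagma.exists_isStandard hw
  exact ⟨⟨t, ht, by rwa [← FreeMagma.length_word]⟩, rfl⟩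

end Necklace

/-! ### The Magnus expansion and the basis of the lower central factors. -/

namespace FreeGroupBasis

open FreeMagma PowerSeries

variable {ι F : Type*} [Group F] (y : FreeGroupBasis ι F)

theorem closure_range : Subgroup.closure (Set.range y) = ⊤ := by
  rw [eq_top_iff]
  intro g _
  let φ : F →* Subgroup.closure (Set.range y) :=
    y.lift fun i => ⟨y i, Subgroup.subset_closure ⟨i, rfl⟩⟩
  have h : (Subgroup.subtype _).comp φ = MonoidHom.id F := y.ext_hom _ _ fun i => by simp [φ]
  rw [show g = φ g from (DFunLike.congr_fun h g).symm]
  exact (φ g).2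

/-- The Magnus expansion, graded by a central variable. -/
noncomputable def magnus : F →* ((MonoidAlgebra ℤ (FreeMonoid ι))⟦X⟧)ˣ :=
  y.lift fun i => oneAddMulX (wordMonomial [i])

theorem hasLead_magnus (i : ι) : HasLead (y.magnus (y i)) 1 (wordMonomial [i]) := by
  have : y.magnus (y i) = oneAddMulX (wordMonomial [i]) := by simp [magnus]
  rw [this]
  exact hasLead_oneAddMulX _

theorem exists_hasLead_magnus (g : F) : ∃ a, HasLead (y.magnus g) 1 a := by
  have hg : g ∈ Subgroup.closure (Set.range y) := by rw [y.closure_range]; trivial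
  induction hg using Subgroup.closure_induction with
  | mem g hg =>
    obtain ⟨i, rfl⟩ := hg
    exact ⟨_, y.hasLead_magnus i⟩
  | one => exact ⟨0, by simpa using hasLead_one 1⟩
  | mul g h _ _ hg hh =>
    obtain ⟨a, ha⟩ := hg
    obtain ⟨b, hb⟩ := hh
    rw [map_mul]
    exact ⟨_, ha.mul hb le_rfl⟩
  | inv g _ hg =>
    obtain ⟨a, ha⟩ := hg
    rw [map_inv]
    exact ⟨_, ha.inv le_rfl⟩

variable [LinearOrder ι]

/-- The class of a standard commutator in its lower central factor. -/
def basicCommutator {n : ℕ} (t : {t : FreeMagma ι // t.IsStandard ∧ t.length = n}) :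
    Additive (LowerCentralFactor F n) :=
  Additive.ofMul (QuotientGroup.mk ⟨t.1.commutator y, by
    have := t.1.commutator_mem y
    rwa [t.2.2] at this⟩)

/-- Independence is pulled back along `leadHom`, which sends these classes to the independent Lie
polynomials. -/
theorem linearIndependent_basicCommutator {n : ℕ} (hn : 1 ≤ n) :
    LinearIndependent ℤ (y.basicCommutator (n := n)) := by
  refine LinearIndependent.of_comp
    (leadHom y.magnus y.exists_hasLead_magnus hn).toIntLinearMap ?_
  convert! linearIndependent_liePoly (α := ι) n with t
  obtain ⟨t, ht, rfl⟩ := t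
  exact (hasLead_commutator y.hasLead_magnus t).coeff_eq hn

theorem span_basicCommutator [Finite ι] {n : ℕ} (hn : 1 ≤ n) :
    ⊤ ≤ Submodule.span ℤ (Set.range (y.basicCommutator (n := n))) := by
  -- `K` is the preimage of the span in γ_n, viewed in `F`, so that generation can be checked on
  -- `standardSpan`.
  let K : Subgroup F := ((AddSubgroup.toSubgroup' (Submodule.span ℤ
    (Set.range (y.basicCommutator (n := n)))).toAddSubgroup).comap
      (QuotientGroup.mk' _)).map (lowerCentralTerm F n).subtype
  have hK : lowerCentralTerm F n ≤ K := by
    rw [lowerCentralTerm_eq_standardSpan _ y.closure_range hn]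
    refine sup_le (fun g hg => ?_) ((Subgroup.closure_le _).2 ?_)
    · refine ⟨⟨g, LowerCentral.antitone_lowerCentralTerm (Nat.le_succ n) hg⟩, ?_, rfl⟩
      have h1 : (QuotientGroup.mk ⟨g, LowerCentral.antitone_lowerCentralTerm (Nat.le_succ n) hg⟩ :
          LowerCentralFactor F n) = 1 := (QuotientGroup.eq_one_iff _).2 hg
      change Additive.ofMul (QuotientGroup.mk _ : LowerCentralFactor F n) ∈ Submodule.span ℤ _
      rw [h1]
      exact zero_mem _
    · rintro _ ⟨t, ht, rfl, -, rfl⟩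
      exact ⟨⟨_, t.commutator_mem y⟩, Submodule.subset_span ⟨⟨t, ht, rfl⟩, rfl⟩, rfl⟩
  rintro x -
  obtain ⟨⟨g, hg⟩, hx⟩ := QuotientGroup.mk_surjective x.toMul
  obtain ⟨h, hh, rfl⟩ := hK hg
  rw [show x = Additive.ofMul (QuotientGroup.mk h) from hx.symm]
  exact hh

/-- The classes of the standard commutators of weight `n` form a basis of the `n`-th lower
central factor of a free group. -/
noncomputable def lowerCentralFactorBasis [Finite ι] {n : ℕ} (hn : 1 ≤ n) :
    Module.Basis {t : FreeMagma ι // t.IsStandard ∧ t.length = n} ℤ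
      (Additive (LowerCentralFactor F n)) :=
  Module.Basis.mk (y.linearIndependent_basicCommutator hn) (y.span_basicCommutator hn)

end FreeGroupBasis

theorem finite_isStandard (α : Type*) [LinearOrder α] [Finite α] (n : ℕ) :
    Finite {t : FreeMagma α // t.IsStandard ∧ t.length = n} :=
  have := (List.finite_length_eq α n).to_subtype
  Finite.of_injective (fun t => (⟨t.1.word, by simp [t.2.2]⟩ : {l : List α | l.length = n}))
    fun s t h => Subtype.ext (s.2.1.word_injective t.2.1 (congrArg Subtype.val h))

theorem theorem5p7 {F : Type*} [Group F] (q : ℕ) (y : FreeGroupBasis (Fin q) F)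
    (w : ℕ) (hw : 0 < w) :
    Module.Free ℤ (Additive (LowerCentralFactor F w)) ∧
    Module.Finite ℤ (Additive (LowerCentralFactor F w)) ∧
    (Module.finrank ℤ (Additive (LowerCentralFactor F w)) : ℚ) =
      (1 / (w : ℚ)) *
        ∑ d ∈ w.divisors, (ArithmeticFunction.moebius d : ℚ) * (q : ℚ) ^ (w / d) := by
  have b := y.lowerCentralFactorBasis hw
  have := finite_isStandard (Fin q) w
  refine ⟨Module.Free.of_basis b, Module.Finite.of_basis b, ?_⟩
  rw [Module.finrank_eq_nat_card_basis b, Necklace.ncard_isStandard, Necklace.lyndonCount_eq hw,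
    Nat.card_fin]
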